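/- Let $\kappa,\sigma,\sigma_n>0$ and $\theta\in\mathbb R$. Let $(X_t)_{t\ge 0}$ be the Ornstein–Uhlenbeck process with continuous paths solving $dX_t=\kappa(\theta-X_t)\,dt+\sigma\,dW_t$, where $W$ is a standard Brownian motion and $X_0\sim\mathcal N(\theta,\sigma^2/(2\kappa))$ is independent of $W$. Let $1\le m\le n$, let $0\le t_1<\dots<t_n$ be sampling times and $t'_1<\dots<t'_n$ reception times with $t_i<t'_i$ for all $i$, and let $t>t'_n$ (all times deterministic). The observations are $Y_{t'_i}=X_{t_i}+N_{t'_i}$, where $N_{t'_1},\dots,N_{t'_n}$ are i.i.d. $\mathcal N(0,\sigma_n^2)$ random variables, independent of the process $X$. The value of information is the mutual information (in nats) $$v(t)=I\big(X_t;\,Y_{t'_n},\dots,Y_{t'_{n-m+1}}\big).$$ Let $\mathbf\Sigma_{\mathbf X}$ be the covariance matrix of $(X_{t_{n-m+1}},\dots,X_{t_n})^{\mathsf T}$, let $\mathbf A=\sigma_n^2\mathbf\Sigma_{\mathbf X}^{-1}+\mathbf I$ (an $m\times m$ matrix), let $\mathbf A_{mm}$ be the $(m-1)\times(m-1)$ matrix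 obtained from $\mathbf A$ by removing its last row and last column (with $\det\mathbf A_{mm}=1$ if $m=1$), and let $\gamma=\frac{\sigma^2}{2\kappa\sigma_n^2}$. Then $\operatorname{Var}[X_{t_i}]/\operatorname{Var}[N_{t'_i}]=\gamma$ for all $i$, the matrices $\mathbf\Sigma_{\mathbf X}$ and $\mathbf A$ are invertible, $v(t)$ is finite, and $$v(t)=\frac12\log\left(\frac{1}{1-e^{-2\kappa(t-t_n)}}\right)-\frac12\log\left(1+\frac{1}{e^{2\kappa(t-t_n)}-1}\cdot\frac{\det(\mathbf A_{mm})}{\gamma\det(\mathbf A)}\right).$$ -/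

import Mathlib

open MeasureTheory ProbabilityTheory
open scoped NNReal ENNReal

/-- The mutual information `I(U; V)` (in nats) of two random variables: the Kullback–Leibler
divergence of the joint law from the product of the marginal laws. -/
noncomputable def mutualInfo {Ω E F : Type*} [MeasurableSpace Ω] [MeasurableSpace E]
    [MeasurableSpace F] (U : Ω → E) (V : Ω → F) (P : Measure Ω) : ℝ≥0∞ :=
  InformationTheory.klDiv (P.map fun ω => (U ω, V ω)) ((P.map U).prod (P.map V))

/-- `X` solves the Ornstein–Uhlenbeck equation `dX = κ (θ - X) dt + σ dW`, where `W` is a standard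
Brownian motion, with initial value `X 0` independent of `W` and of law `N(θ, σ² / (2κ))`.
Since the diffusion coefficient is the constant `σ`, the stochastic integral `∫₀ᵗ σ dW` is
`σ * W t` (and `W 0 = 0` almost surely). -/
structure IsStationaryOU {Ω : Type*} [MeasurableSpace Ω] (κ θ σ : ℝ) (W X : ℝ≥0 → Ω → ℝ)
    (P : Measure Ω) : Prop where
  brownian : IsBrownianReal W P
  aemeasurable : ∀ t, AEMeasurable (X t) P
  initial : HasLaw (X 0) (gaussianReal θ (σ ^ 2 / (2 * κ)).toNNReal) P
  indep : IndepFun (X 0) (fun ω t => W t ω) P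
  continuous_paths : ∀ᵐ ω ∂P, Continuous fun t => X t ω
  sde : ∀ᵐ ω ∂P, ∀ t : ℝ≥0,
    X t ω = X 0 ω + (∫ s in (0 : ℝ)..(t : ℝ), κ * (θ - X s.toNNReal ω)) + σ * W t ω

/-- The noise values `N (τ' i)`, `1 ≤ i ≤ n`, are i.i.d. with law `N(0, σn²)`, and they are
independent of the process `X`. -/
structure IsChannelNoise {Ω : Type*} [MeasurableSpace Ω] (σn : ℝ) (n : ℕ) (τ' : ℕ → ℝ≥0)
    (X N : ℝ≥0 → Ω → ℝ) (P : Measure Ω) : Prop where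
  law : ∀ i ∈ Set.Icc 1 n, HasLaw (N (τ' i)) (gaussianReal 0 (σn ^ 2).toNNReal) P
  iIndep : iIndepFun (fun i : Set.Icc 1 n => N (τ' i)) P
  indep : IndepFun (fun ω s => X s ω) (fun ω (i : Set.Icc 1 n) => N (τ' i) ω) P

/-- The observation `Y_{τ' i} = X_{τ i} + N_{τ' i}`. -/
def observation {Ω : Type*} (τ τ' : ℕ → ℝ≥0) (X N : ℝ≥0 → Ω → ℝ) (i : ℕ) (ω : Ω) : ℝ :=
  X (τ i) ω + N (τ' i) ω

/-- The `j`-th index (`j = 0, …, m - 1`) of the window `n - m + 1, …, n`; used for `m ≤ n`. -/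
def windowIndex (n m : ℕ) (j : Fin m) : ℕ := n - m + 1 + j

/-- The value of information
`v(t) = I(X_t; Y_{τ' n}, …, Y_{τ' (n - m + 1)})` of the `m` most recent of `n` observations. -/
noncomputable def valueOfInformation {Ω : Type*} [MeasurableSpace Ω] (n m : ℕ) (τ τ' : ℕ → ℝ≥0)
    (X N : ℝ≥0 → Ω → ℝ) (P : Measure Ω) (t : ℝ≥0) : ℝ≥0∞ :=
  mutualInfo (X t) (fun ω (j : Fin m) => observation τ τ' X N (windowIndex n m j) ω) P

/-- The covariance matrix `Σ_X` of `(X_{τ (n - m + 1)}, …, X_{τ n})`. -/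
noncomputable def sampleCovariance {Ω : Type*} [MeasurableSpace Ω] (n m : ℕ) (τ : ℕ → ℝ≥0)
    (X : ℝ≥0 → Ω → ℝ) (P : Measure Ω) : Matrix (Fin m) (Fin m) ℝ :=
  Matrix.of fun i j => cov[X (τ (windowIndex n m i)), X (τ (windowIndex n m j)); P]

/-- The matrix `A = σn² Σ_X⁻¹ + I`. -/
noncomputable def matrixA {Ω : Type*} [MeasurableSpace Ω] (σn : ℝ) (n m : ℕ) (τ : ℕ → ℝ≥0)
    (X : ℝ≥0 → Ω → ℝ) (P : Measure Ω) : Matrix (Fin m) (Fin m) ℝ :=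
  σn ^ 2 • (sampleCovariance n m τ X P)⁻¹ + 1

/-- The `(m - 1) × (m - 1)` matrix obtained by removing the last row and the last column. -/
def removeLast {m : ℕ} (A : Matrix (Fin m) (Fin m) ℝ) : Matrix (Fin (m - 1)) (Fin (m - 1)) ℝ :=
  A.submatrix (Fin.castLE (Nat.sub_le m 1)) (Fin.castLE (Nat.sub_le m 1))

/-! Everything is Gaussian, so the information is half the log of a ratio of variances. Put r =
σ²/(2κ). The SDE has additive noise, so a pathwise exponential Euler scheme recovers the process
from `X 0` and increments of `W`. Passing to the limit in characteristic functions, `X - θ` is a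
centered Gaussian process with covariance r·exp(-κ|t-s|)
(`IsStationaryOU.isGaussianProcess_centered`).

With S = Σ_X, the observed window has covariance S + σn²I = SA, and its covariance with `X t` is e =
exp(-κ(t - τ n)) times the last column of S. The regression coefficients are therefore e times the
last column of A⁻¹, and `gaussian_regression_residual` gives an independent residual of variance w =
r - e²(r - σn²·(A⁻¹)ₘₘ). By `mutualInfo_of_indepFun_residual` the information is ½ log(r/w).
Cramer's rule turns (A⁻¹)ₘₘ into det A_mm / det A, and algebra does the rest. -/

/-! ### Limits and linear combinations of Gaussian processes. -/

open Filter Topology in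
/-- An almost sure limit of centered real Gaussian variables with converging variances is
Gaussian. -/
lemma hasLaw_gaussianReal_of_tendsto {Ω : Type*} [MeasurableSpace Ω] {P : Measure Ω}
    [IsProbabilityMeasure P] {Y : ℕ → Ω → ℝ} {Z : Ω → ℝ} {v : ℕ → ℝ≥0} {w : ℝ≥0}
    (hY : ∀ k, HasLaw (Y k) (gaussianReal 0 (v k)) P) (hZ : AEMeasurable Z P)
    (hlim : ∀ᵐ ω ∂P, Tendsto (fun k => Y k ω) atTop (𝓝 (Z ω)))
    (hv : Tendsto v atTop (𝓝 w)) : HasLaw Z (gaussianReal 0 w) P := by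
  refine ⟨hZ, ?_⟩
  have : IsProbabilityMeasure (P.map Z) := Measure.isProbabilityMeasure_map hZ
  refine Measure.ext_of_charFun (funext fun u => ?_)
  have h1 : Tendsto (fun k => ∫ ω, Complex.exp (u * (Y k ω : ℂ) * Complex.I) ∂P) atTop
      (𝓝 (∫ ω, Complex.exp (u * (Z ω : ℂ) * Complex.I) ∂P)) := by
    refine tendsto_integral_of_dominated_convergence (fun _ => 1) (fun k => ?_)
      (integrable_const _) (fun k => ?_) ?_
    · have := (hY k).aemeasurable
      exact (by fun_prop : AEMeasurable
        (fun ω => Complex.exp (u * (Y k ω : ℂ) * Complex.I)) P).aestronglyMeasurable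
    · refine Eventually.of_forall fun ω => ?_
      rw [← Complex.ofReal_mul, Complex.norm_exp_ofReal_mul_I]
    · filter_upwards [hlim] with ω hω
      exact ((Continuous.tendsto (f := fun y : ℝ => Complex.exp (u * (y : ℂ) * Complex.I))
        (by fun_prop) (Z ω)).comp hω)
  have h2 : ∀ k, ∫ ω, Complex.exp (u * (Y k ω : ℂ) * Complex.I) ∂P =
      Complex.exp (-((v k : ℝ) : ℂ) * u ^ 2 / 2) := by
    intro k
    have := charFun_gaussianReal (μ := 0) (v := v k) u
    rw [← (hY k).map_eq, charFun_apply_real, integral_map (hY k).aemeasurable (by fun_prop)] at this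
    rw [this]
    congr 1
    push_cast
    ring
  simp_rw [h2] at h1
  have h3 : Tendsto (fun k => Complex.exp (-((v k : ℝ) : ℂ) * u ^ 2 / 2)) atTop
      (𝓝 (Complex.exp (-((w : ℝ) : ℂ) * u ^ 2 / 2))) :=
    (Continuous.tendsto (f := fun y : ℝ≥0 => Complex.exp (-((y : ℝ) : ℂ) * u ^ 2 / 2))
        (by fun_prop) w).comp hv
  rw [charFun_apply_real, integral_map hZ (by fun_prop), tendsto_nhds_unique h1 h3,
    charFun_gaussianReal]
  congr 1
  push_cast
  ring

/-- Every finite linear combination of a real Gaussian process is Gaussian. -/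
lemma ProbabilityTheory.IsGaussianProcess.hasGaussianLaw_of_mem_span {Ω T : Type*}
    [MeasurableSpace Ω] {P : Measure Ω} {G : T → Ω → ℝ} (hG : IsGaussianProcess G P) {Y : Ω → ℝ}
    (hY : Y ∈ Submodule.span ℝ (Set.range G)) : HasGaussianLaw Y P := by
  obtain ⟨c, rfl⟩ := Finsupp.mem_span_range_iff_exists_finsupp.1 hY
  exact (hG.smul c).hasGaussianLaw_sum

/-- A process all of whose finite linear combinations are Gaussian is a Gaussian process. -/
lemma isGaussianProcess_of_forall_sum {Ω T : Type*} [MeasurableSpace Ω] {P : Measure Ω}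
    {X : T → Ω → ℝ} (hX : ∀ t, AEMeasurable (X t) P)
    (h : ∀ (I : Finset T) (c : I → ℝ), HasGaussianLaw (fun ω => ∑ i, c i * X i ω) P) :
    IsGaussianProcess X P where
  hasGaussianLaw I := by
    classical
    have hm : AEMeasurable (fun ω => I.restrict (X · ω)) P :=
      aemeasurable_pi_lambda _ fun i => hX i
    refine ⟨isGaussian_of_map_eq_gaussianReal fun L => ?_⟩
    have hL : (L ∘ fun ω => I.restrict (X · ω)) =
        fun ω => ∑ i, L (Pi.single i 1) * X i ω := by
      ext ω
      have := L.toLinearMap.pi_apply_eq_sum_univ (I.restrict (X · ω))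
      simp only [ContinuousLinearMap.coe_coe, smul_eq_mul] at this
      simp only [Function.comp_apply, this, Finset.restrict]
      refine Finset.sum_congr rfl fun i _ => ?_
      rw [mul_comm]
      congr 2
      ext j
      simp [Pi.single_apply, eq_comm]
    have hlaw := h I fun i => L (Pi.single i 1)
    rw [AEMeasurable.map_map_of_aemeasurable (by fun_prop) hm, hL]
    exact ⟨_, _, hlaw.map_eq_gaussianReal⟩

/-- A process whose variables are finite linear combinations of a Gaussian process is Gaussian. -/
lemma ProbabilityTheory.IsGaussianProcess.of_mem_span {Ω S T : Type*}
    [MeasurableSpace Ω] {P : Measure Ω} {G : T → Ω → ℝ} (hG : IsGaussianProcess G P)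
    {Y : S → Ω → ℝ} (hY : ∀ s, Y s ∈ Submodule.span ℝ (Set.range G)) : IsGaussianProcess Y P := by
  refine isGaussianProcess_of_forall_sum
    (fun s => (hG.hasGaussianLaw_of_mem_span (hY s)).aemeasurable) fun I c => ?_
  have : (fun ω => ∑ i, c i * Y i ω) = ∑ i, c i • Y i := by ext ω; simp
  rw [this]
  exact hG.hasGaussianLaw_of_mem_span
    (Submodule.sum_mem _ fun i _ => Submodule.smul_mem _ _ (hY i))

open Filter Topology in
/-- A pointwise almost sure limit of centered Gaussian processes with converging covariances is a
centered Gaussian process with the limiting covariance. -/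
lemma isGaussianProcess_of_tendsto {Ω T : Type*} [MeasurableSpace Ω] {P : Measure Ω}
    {X : ℕ → T → Ω → ℝ} {Z : T → Ω → ℝ} {C : T → T → ℝ}
    (hX : ∀ k, IsGaussianProcess (X k) P) (hmean : ∀ k t, P[X k t] = 0)
    (hZ : ∀ t, AEMeasurable (Z t) P)
    (hlim : ∀ t, ∀ᵐ ω ∂P, Tendsto (fun k => X k t ω) atTop (𝓝 (Z t ω)))
    (hC : ∀ s t, Tendsto (fun k => cov[X k s, X k t; P]) atTop (𝓝 (C s t))) :
    IsGaussianProcess Z P ∧ (∀ t, P[Z t] = 0) ∧ ∀ s t, cov[Z s, Z t; P] = C s t := by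
  have hP : IsProbabilityMeasure P := (hX 0).isProbabilityMeasure
  have hX2 : ∀ k t, MemLp (X k t) 2 P := fun k t => ((hX k).hasGaussianLaw_eval t).memLp_two
  -- Cramér–Wold: one-dimensional laws of all combinations suffice. Nonnegativity is recorded so
  -- that `toNNReal` does not truncate the limiting variance.
  have key : ∀ (n : ℕ) (f : Fin n → T) (c : Fin n → ℝ),
      0 ≤ ∑ i, ∑ j, c i * (c j * C (f i) (f j)) ∧
      HasLaw (fun ω => ∑ i, c i * Z (f i) ω)
        (gaussianReal 0 (∑ i, ∑ j, c i * (c j * C (f i) (f j))).toNNReal) P := by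
    intro n f c
    have hvar : ∀ k, Var[fun ω => ∑ i, c i * X k (f i) ω; P] =
        ∑ i, ∑ j, c i * (c j * cov[X k (f i), X k (f j); P]) := by
      intro k
      rw [← covariance_self, covariance_fun_sum_fun_sum (fun i => (hX2 k (f i)).const_mul (c i))
        (fun i => (hX2 k (f i)).const_mul (c i))]
      · simp_rw [covariance_const_mul_left, covariance_const_mul_right]
      · exact (memLp_finsetSum _ fun i _ => (hX2 k (f i)).const_mul (c i)).aemeasurable
    have ht : Tendsto (fun k => Var[fun ω => ∑ i, c i * X k (f i) ω; P]) atTop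
        (𝓝 (∑ i, ∑ j, c i * (c j * C (f i) (f j)))) := by
      simp_rw [hvar]
      exact tendsto_finsetSum _ fun i _ => tendsto_finsetSum _ fun j _ =>
        ((hC _ _).const_mul _).const_mul _
    refine ⟨ge_of_tendsto' ht fun k => variance_nonneg _ _, ?_⟩
    refine hasLaw_gaussianReal_of_tendsto (Y := fun k ω => ∑ i, c i * X k (f i) ω)
      (fun k => ?_) ?_ ?_ ((continuous_real_toNNReal.tendsto _).comp ht)
    · have hg : HasGaussianLaw (fun ω => ∑ i, c i * X k (f i) ω) P := by
        have : (fun ω => ∑ i, c i * X k (f i) ω) = ∑ i, c i • X k (f i) := by ext ω; simp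
        rw [this]
        exact (hX k).hasGaussianLaw_of_mem_span (Submodule.sum_mem _ fun i _ =>
          Submodule.smul_mem _ _ (Submodule.subset_span ⟨_, rfl⟩))
      refine ⟨hg.aemeasurable, ?_⟩
      rw [hg.map_eq_gaussianReal]
      congr 1
      rw [integral_finsetSum _ fun i _ => ((hX2 k (f i)).integrable one_le_two).const_mul _]
      exact Finset.sum_eq_zero fun i _ => by rw [integral_const_mul, hmean, mul_zero]
    · exact Finset.aemeasurable_fun_sum _ fun i _ => (hZ _).const_mul _
    · have : ∀ᵐ ω ∂P, ∀ i, Tendsto (fun k => X k (f i) ω) atTop (𝓝 (Z (f i) ω)) :=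
        ae_all_iff.2 fun i => hlim _
      filter_upwards [this] with ω hω
      exact tendsto_finsetSum _ fun i _ => (hω i).const_mul _
  have hvar : ∀ (n : ℕ) (f : Fin n → T) (c : Fin n → ℝ),
      Var[fun ω => ∑ i, c i * Z (f i) ω; P] = ∑ i, ∑ j, c i * (c j * C (f i) (f j)) := by
    intro n f c
    obtain ⟨h0, hl⟩ := key n f c
    rw [hl.variance_eq, variance_id_gaussianReal, Real.coe_toNNReal _ h0]
  have hG : IsGaussianProcess Z P := by
    refine isGaussianProcess_of_forall_sum hZ fun I c => ?_
    have := (key _ (fun i => (I.equivFin.symm i : T)) fun i => c (I.equivFin.symm i)).2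
    refine this.hasGaussianLaw.congr (Eventually.of_forall fun ω => ?_)
    exact Equiv.sum_comp I.equivFin.symm fun i => c i * Z i ω
  have hZ2 : ∀ t, MemLp (Z t) 2 P := fun t => (hG.hasGaussianLaw_eval t).memLp_two
  refine ⟨hG, fun t => ?_, fun s t => ?_⟩
  · have := (key 1 (fun _ => t) fun _ => 1).2.integral_eq
    simpa using this
  · have hs := hvar 1 (fun _ => s) fun _ => 1
    have ht := hvar 1 (fun _ => t) fun _ => 1
    -- Polarization: the covariance is read off from the variances of Z s, Z t and Z s + Z t.
    have hst := hvar 2 ![s, t] fun _ => 1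
    have hsymm : C s t = C t s := tendsto_nhds_unique (hC s t) (by
      simp_rw [covariance_comm (X _ s)]; exact hC t s)
    simp only [Fin.sum_univ_two, Finset.univ_unique, Finset.sum_singleton, one_mul,
      Matrix.cons_val_zero, Matrix.cons_val_one] at hs ht hst
    rw [variance_fun_add (hZ2 s) (hZ2 t)] at hst
    linarith

/-! ### The exponential Euler scheme, pathwise. -/

open Filter Topology Set in
/-- One step of the exponential Euler scheme for `dz = -κ z ds + dv`. -/
lemma abs_euler_step_le {κ a b ε : ℝ} {z : ℝ → ℝ} (hz : Continuous z) (hab : a ≤ b)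
    (hε : ∀ r ∈ Icc a b, |κ * Real.exp (κ * r) * z a - κ * Real.exp (κ * b) * z r| ≤ ε) :
    |(Real.exp (κ * b) * z b - Real.exp (κ * a) * z a) -
      Real.exp (κ * b) * (z b - z a + κ * ∫ r in a..b, z r)| ≤ ε * (b - a) := by
  have h1 : ∫ r in a..b, κ * Real.exp (κ * r) = Real.exp (κ * b) - Real.exp (κ * a) := by
    refine intervalIntegral.integral_eq_sub_of_hasDerivAt (f := fun r => Real.exp (κ * r))
      (fun r _ => ?_) (Continuous.intervalIntegrable (by fun_prop) _ _)
    simpa [mul_comm] using ((hasDerivAt_id r).const_mul κ).exp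
  have h2 : (Real.exp (κ * b) * z b - Real.exp (κ * a) * z a) -
      Real.exp (κ * b) * (z b - z a + κ * ∫ r in a..b, z r) =
      ∫ r in a..b, (κ * Real.exp (κ * r) * z a - κ * Real.exp (κ * b) * z r) := by
    rw [intervalIntegral.integral_sub (Continuous.intervalIntegrable (by fun_prop) _ _)
      (Continuous.intervalIntegrable (by fun_prop) _ _), intervalIntegral.integral_mul_const, h1,
      intervalIntegral.integral_const_mul]
    ring
  rw [h2, ← abs_of_nonneg (sub_nonneg.2 hab), ← Real.norm_eq_abs (∫ _ in a..b, _)]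
  refine intervalIntegral.norm_integral_le_of_norm_le_const fun r hr => ?_
  rw [uIoc_of_le hab] at hr
  exact hε r ⟨hr.1.le, hr.2⟩

open Filter Topology Set in
/-- Convergence of the exponential Euler scheme for `dz = -κ z ds + dv`. -/
lemma tendsto_euler_sum {κ : ℝ} {z v : ℝ → ℝ} (hz : Continuous z)
    (hv : ∀ a b, 0 ≤ a → a ≤ b → v b - v a = z b - z a + κ * ∫ r in a..b, z r)
    {t : ℝ} (ht : 0 ≤ t) :
    Tendsto (fun k : ℕ => ∑ j ∈ Finset.range ⌊t * (k + 1)⌋₊,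
      Real.exp (κ * ((j + 1) / (k + 1))) * (v ((j + 1) / (k + 1)) - v (j / (k + 1))))
      atTop (𝓝 (Real.exp (κ * t) * z t - z 0)) := by
  set M : ℝ → ℝ := fun s => Real.exp (κ * s) * z s with hM
  have hMc : Continuous M := by fun_prop
  have hgrid : Tendsto (fun k : ℕ => (⌊t * (k + 1)⌋₊ : ℝ) / (k + 1)) atTop (𝓝 t) := by
    have := (tendsto_nat_floor_mul_div_atTop ht).comp
      ((tendsto_natCast_atTop_atTop (R := ℝ)).comp (tendsto_add_atTop_nat 1))
    simpa [Function.comp_def] using this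
  -- The increments of M telescope to its value at the last grid point before t; it remains to
  -- compare them with the Euler increments.
  have hmain : Tendsto (fun k : ℕ => (M ((⌊t * (k + 1)⌋₊ : ℝ) / (k + 1)) - M 0)) atTop
      (𝓝 (Real.exp (κ * t) * z t - z 0)) := by
    have := ((hMc.tendsto t).comp hgrid).sub_const (M 0)
    simpa [hM] using this
  refine tendsto_of_tendsto_of_dist hmain ?_
  rw [Metric.tendsto_atTop]
  intro ε hε
  -- The one-step error compares this function at (r, a) and (b, r), two points within one mesh
  -- width in each coordinate; uniform continuity on the square controls all steps at once.
  have hF : Continuous fun p : ℝ × ℝ => κ * Real.exp (κ * p.1) * z p.2 := by fun_prop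
  have hU := (isCompact_Icc (a := (0 : ℝ)) (b := t)).prod (isCompact_Icc (a := (0 : ℝ)) (b := t))
    |>.uniformContinuousOn_of_continuous hF.continuousOn
  rw [Metric.uniformContinuousOn_iff] at hU
  -- Dividing by t + 1 instead of t covers t = 0.
  have hε' : 0 < ε / (t + 1) := by positivity
  obtain ⟨δ, hδ, hU⟩ := hU _ hε'
  obtain ⟨K, hK⟩ := exists_nat_gt (1 / δ)
  refine ⟨K, fun k hk => ?_⟩
  have hk0 : (0 : ℝ) < k + 1 := by positivity
  have hkδ : 1 / (k + 1 : ℝ) < δ := by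
    rw [div_lt_comm₀ hk0 hδ]
    have : (K : ℝ) ≤ k := by exact_mod_cast hk
    linarith
  set n := ⌊t * (k + 1)⌋₊ with hn
  have hnt : (n : ℝ) / (k + 1) ≤ t := by
    rw [div_le_iff₀ hk0]
    exact Nat.floor_le (by positivity)
  have htel : M ((n : ℝ) / (k + 1)) - M 0 =
      ∑ j ∈ Finset.range n, (M (((j + 1 : ℕ) : ℝ) / (k + 1)) - M ((j : ℝ) / (k + 1))) := by
    rw [Finset.sum_range_sub fun j : ℕ => M ((j : ℝ) / (k + 1))]
    simp
  rw [Real.dist_eq, sub_zero, abs_of_nonneg dist_nonneg, Real.dist_eq, htel,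
    ← Finset.sum_sub_distrib]
  have hstep : ∀ j ∈ Finset.range n,
      |(M (((j + 1 : ℕ) : ℝ) / (k + 1)) - M ((j : ℝ) / (k + 1))) -
        Real.exp (κ * ((j + 1) / (k + 1))) * (v ((j + 1) / (k + 1)) - v (j / (k + 1)))|
        ≤ ε / (t + 1) * (1 / (k + 1)) := by
    intro j hj
    have hj' : ((j : ℝ) + 1) ≤ n := by exact_mod_cast Finset.mem_range.1 hj
    have ha : (0 : ℝ) ≤ j / (k + 1) := by positivity
    have hab : (j : ℝ) / (k + 1) ≤ (j + 1) / (k + 1) := by gcongr; linarith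
    have hb : ((j : ℝ) + 1) / (k + 1) ≤ t := le_trans (by gcongr) hnt
    have hd : ((j : ℝ) + 1) / (k + 1) - j / (k + 1) = 1 / (k + 1) := by ring
    have := abs_euler_step_le (κ := κ) (ε := ε / (t + 1)) hz hab (fun r hr => ?_)
    · rw [hd] at this
      rw [hv _ _ ha hab]
      push_cast
      exact this
    · have h := (hU (r, (j : ℝ) / (k + 1))
        ⟨⟨ha.trans hr.1, hr.2.trans hb⟩, ⟨ha, hab.trans hb⟩⟩
        (((j : ℝ) + 1) / (k + 1), r) ⟨⟨ha.trans hab, hb⟩, ⟨ha.trans hr.1, hr.2.trans hb⟩⟩ ?_).le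
      · simpa [Real.dist_eq] using h
      · rw [Prod.dist_eq, max_lt_iff, Real.dist_eq, Real.dist_eq, abs_lt, abs_lt]
        obtain ⟨h1, h2⟩ := hr
        exact ⟨⟨by linarith, by linarith⟩, ⟨by linarith, by linarith⟩⟩
  calc _ ≤ ∑ j ∈ Finset.range n, ε / (t + 1) * (1 / (k + 1)) :=
        (Finset.abs_sum_le_sum_abs _ _).trans (Finset.sum_le_sum hstep)
    _ = ε / (t + 1) * ((n : ℝ) / (k + 1)) := by
        rw [Finset.sum_const, Finset.card_range, nsmul_eq_mul]; ring
    _ ≤ ε / (t + 1) * t := by gcongr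
    _ < ε := by
        rw [div_mul_eq_mul_div, div_lt_iff₀ (by positivity)]
        nlinarith

/-! ### The Ornstein–Uhlenbeck process as a Gaussian process. -/

/-- Two independent real Gaussian processes are jointly Gaussian. -/
lemma ProbabilityTheory.IndepFun.isGaussianProcess_sumElim {Ω S T : Type*} [MeasurableSpace Ω]
    {P : Measure Ω} {X : S → Ω → ℝ} {Y : T → Ω → ℝ} (hX : IsGaussianProcess X P)
    (hY : IsGaussianProcess Y P) (h : IndepFun (fun ω s => X s ω) (fun ω t => Y t ω) P) :
    IsGaussianProcess (Sum.elim X Y) P := by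
  refine isGaussianProcess_of_forall_sum (fun i => ?_) fun I c => ?_
  · cases i with
    | inl s => exact hX.aemeasurable s
    | inr t => exact hY.aemeasurable t
  have hmem : (fun ω => ∑ i, c i * Sum.elim X Y i ω) ∈
      Submodule.span ℝ (Set.range X) ⊔ Submodule.span ℝ (Set.range Y) := by
    have : (fun ω => ∑ i, c i * Sum.elim X Y i ω) = ∑ i, c i • Sum.elim X Y i := by ext ω; simp
    rw [this, ← Submodule.span_union, ← Set.Sum.elim_range]
    exact Submodule.sum_mem _ fun i _ => Submodule.smul_mem _ _ (Submodule.subset_span ⟨_, rfl⟩)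
  -- A combination splits into a part from X and a part from Y, which are independent Gaussians.
  obtain ⟨U, hU, V, hV, hUV⟩ := Submodule.mem_sup.1 hmem
  rw [← hUV]
  have hUg := hX.hasGaussianLaw_of_mem_span hU
  have hVg := hY.hasGaussianLaw_of_mem_span hV
  obtain ⟨a, rfl⟩ := Finsupp.mem_span_range_iff_exists_finsupp.1 hU
  obtain ⟨b, rfl⟩ := Finsupp.mem_span_range_iff_exists_finsupp.1 hV
  refine (IndepFun.hasGaussianLaw hUg hVg ?_).add
  have hφ : Measurable fun x : S → ℝ => ∑ i ∈ a.support, a i * x i :=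
    Finset.measurable_fun_sum _ fun i _ => (measurable_pi_apply i).const_mul _
  have hψ : Measurable fun x : T → ℝ => ∑ i ∈ b.support, b i * x i :=
    Finset.measurable_fun_sum _ fun i _ => (measurable_pi_apply i).const_mul _
  convert h.comp hφ hψ using 1
  · ext ω; simp [Finsupp.sum]
  · ext ω; simp [Finsupp.sum]

/-- The covariance of two increments of Brownian motion over intervals of a regular grid. -/
lemma covariance_brownian_grid_increments {Ω : Type*} [MeasurableSpace Ω] {P : Measure Ω}
    [IsProbabilityMeasure P] {W : ℝ≥0 → Ω → ℝ} (hW : IsPreBrownianReal W P) (k i j : ℕ) :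
    cov[fun ω => W ((i + 1) / (k + 1)) ω - W (i / (k + 1)) ω,
      fun ω => W ((j + 1) / (k + 1)) ω - W (j / (k + 1)) ω; P] =
      if i = j then 1 / (k + 1 : ℝ) else 0 := by
  have hm : ∀ t, MemLp (W t) 2 P :=
    fun t => (hW.isGaussianProcess.hasGaussianLaw_eval t).memLp_two
  rw [covariance_fun_sub_fun_sub (hm _) (hm _) (hm _) (hm _)]
  simp only [hW.covariance_eval, NNReal.coe_min, NNReal.coe_div, NNReal.coe_add, NNReal.coe_one,
    NNReal.coe_natCast, min_div_div_right (by positivity : (0 : ℝ) ≤ k + 1)]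
  rcases lt_trichotomy i j with h | h | h
  · have : (i : ℝ) + 1 ≤ j := by exact_mod_cast h
    rw [min_eq_left (by linarith), min_eq_left (by linarith), min_eq_left (by linarith),
      min_eq_left (by linarith), if_neg h.ne]
    ring
  · subst h
    rw [min_self, min_self, min_eq_right (by linarith), min_eq_left (by linarith), if_pos rfl]
    ring
  · have : (j : ℝ) + 1 ≤ i := by exact_mod_cast h
    rw [min_eq_right (by linarith), min_eq_right (by linarith), min_eq_right (by linarith),
      min_eq_right (by linarith), if_neg h.ne']
    ring

/-- The exponential Euler approximation of `exp (κ t) * Z t`, where `dZ = -κ Z dt + σ dW`. -/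
noncomputable def eulerApprox {Ω : Type*} (κ σ : ℝ) (Z₀ : Ω → ℝ) (W : ℝ≥0 → Ω → ℝ) (k : ℕ)
    (t : ℝ≥0) (ω : Ω) : ℝ :=
  Z₀ ω + ∑ j ∈ Finset.range ⌊(t : ℝ) * (k + 1)⌋₊, Real.exp (κ * ((j + 1) / (k + 1))) *
    (σ * (W ((j + 1) / (k + 1)) ω - W (j / (k + 1)) ω))

lemma eulerApprox_mem_span {Ω : Type*} (κ σ : ℝ) (Z₀ : Ω → ℝ) (W : ℝ≥0 → Ω → ℝ) (k : ℕ)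
    (t : ℝ≥0) : eulerApprox κ σ Z₀ W k t ∈
      Submodule.span ℝ (Set.range (Sum.elim (fun _ : Unit => Z₀) W)) := by
  have hW : ∀ s, W s ∈ Submodule.span ℝ (Set.range (Sum.elim (fun _ : Unit => Z₀) W)) :=
    fun s => Submodule.subset_span ⟨Sum.inr s, rfl⟩
  have : eulerApprox κ σ Z₀ W k t = Z₀ + ∑ j ∈ Finset.range ⌊(t : ℝ) * (k + 1)⌋₊,
      Real.exp (κ * ((j + 1) / (k + 1))) • σ • (W ((j + 1) / (k + 1)) - W (j / (k + 1))) := by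
    ext ω; simp [eulerApprox]
  rw [this]
  exact Submodule.add_mem _ (Submodule.subset_span ⟨Sum.inl (), rfl⟩)
    (Submodule.sum_mem _ fun j _ => Submodule.smul_mem _ _ (Submodule.smul_mem _ _
      (Submodule.sub_mem _ (hW _) (hW _))))

/-- Distinct grid cells are uncorrelated, as are `Z₀` and `W`, so only the cells common to both sums
survive. The result has the shape of an Euler sum with rate 2κ and driver σ²s, so
`tendsto_euler_sum` also yields its limit. -/
lemma covariance_eulerApprox {Ω : Type*} [MeasurableSpace Ω] {P : Measure Ω}
    [IsProbabilityMeasure P] (κ σ : ℝ) {Z₀ : Ω → ℝ} {W : ℝ≥0 → Ω → ℝ}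
    (hW : IsPreBrownianReal W P) (hZ₀ : MemLp Z₀ 2 P) (hc : ∀ t, cov[Z₀, W t; P] = 0)
    (k : ℕ) (s t : ℝ≥0) :
    cov[eulerApprox κ σ Z₀ W k s, eulerApprox κ σ Z₀ W k t; P] = Var[Z₀; P] +
      ∑ j ∈ Finset.range ⌊((min s t : ℝ≥0) : ℝ) * (k + 1)⌋₊,
        Real.exp (2 * κ * ((j + 1) / (k + 1))) *
          (σ ^ 2 * ((j + 1) / (k + 1)) - σ ^ 2 * (j / (k + 1))) := by
  have hm : ∀ t, MemLp (W t) 2 P :=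
    fun t => (hW.isGaussianProcess.hasGaussianLaw_eval t).memLp_two
  have hD : ∀ j : ℕ, MemLp (fun ω => Real.exp (κ * ((j + 1) / (k + 1))) *
      (σ * (W ((j + 1) / (k + 1)) ω - W (j / (k + 1)) ω))) 2 P :=
    fun j => (((hm _).sub (hm _)).const_mul _).const_mul _
  have h0 : ∀ j : ℕ, cov[Z₀, fun ω => Real.exp (κ * ((j + 1) / (k + 1))) *
      (σ * (W ((j + 1) / (k + 1)) ω - W (j / (k + 1)) ω)); P] = 0 := by
    intro j
    rw [covariance_const_mul_right, covariance_const_mul_right,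
      covariance_fun_sub_right hZ₀ (hm _) (hm _), hc, hc]
    simp
  have hS : ∀ n : ℕ, MemLp (fun ω => ∑ j ∈ Finset.range n, Real.exp (κ * ((j + 1) / (k + 1))) *
      (σ * (W ((j + 1) / (k + 1)) ω - W (j / (k + 1)) ω))) 2 P :=
    fun n => memLp_finsetSum _ fun j _ => hD j
  have h0S : ∀ n : ℕ, cov[Z₀, fun ω => ∑ j ∈ Finset.range n,
      Real.exp (κ * ((j + 1) / (k + 1))) *
      (σ * (W ((j + 1) / (k + 1)) ω - W (j / (k + 1)) ω)); P] = 0 := by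
    intro n
    rw [covariance_fun_sum_right' (fun j _ => hD j) hZ₀]
    exact Finset.sum_eq_zero fun j _ => h0 j
  have hS0 : ∀ n : ℕ, cov[fun ω => ∑ j ∈ Finset.range n,
      Real.exp (κ * ((j + 1) / (k + 1))) *
      (σ * (W ((j + 1) / (k + 1)) ω - W (j / (k + 1)) ω)), Z₀; P] = 0 := by
    intro n
    rw [covariance_comm, h0S]
  have hSS : ∀ n n' : ℕ, cov[fun ω => ∑ j ∈ Finset.range n,
      Real.exp (κ * ((j + 1) / (k + 1))) *
      (σ * (W ((j + 1) / (k + 1)) ω - W (j / (k + 1)) ω)), fun ω => ∑ j ∈ Finset.range n',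
      Real.exp (κ * ((j + 1) / (k + 1))) *
      (σ * (W ((j + 1) / (k + 1)) ω - W (j / (k + 1)) ω)); P] =
      ∑ j ∈ Finset.range (min n n'), Real.exp (2 * κ * ((j + 1) / (k + 1))) *
          (σ ^ 2 * ((j + 1) / (k + 1)) - σ ^ 2 * (j / (k + 1))) := by
    intro n n'
    rw [covariance_fun_sum_fun_sum' (fun j _ => hD j) (fun j _ => hD j)]
    simp only [covariance_const_mul_left, covariance_const_mul_right,
      covariance_brownian_grid_increments hW, mul_ite, mul_zero, Finset.sum_ite_eq,
      Finset.mem_range]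
    rw [← Finset.sum_filter]
    refine Finset.sum_congr (by ext j; simp) fun j _ => ?_
    have : 2 * κ * (((j : ℝ) + 1) / (k + 1)) =
      κ * (((j : ℝ) + 1) / (k + 1)) + κ * (((j : ℝ) + 1) / (k + 1)) := by ring
    rw [this, Real.exp_add]
    ring
  have hmin : ⌊((min s t : ℝ≥0) : ℝ) * (k + 1)⌋₊ =
      min ⌊(s : ℝ) * (k + 1)⌋₊ ⌊(t : ℝ) * (k + 1)⌋₊ := by
    have hmono : Monotone fun u : ℝ≥0 => ⌊(u : ℝ) * (k + 1)⌋₊ :=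
      fun a b hab => Nat.floor_le_floor (by gcongr)
    exact hmono.map_min
  have hadd : ∀ u, eulerApprox κ σ Z₀ W k u = Z₀ + fun ω =>
      ∑ j ∈ Finset.range ⌊(u : ℝ) * (k + 1)⌋₊, Real.exp (κ * ((j + 1) / (k + 1))) *
        (σ * (W ((j + 1) / (k + 1)) ω - W (j / (k + 1)) ω)) := fun u => rfl
  rw [hadd, hadd, covariance_add_left hZ₀ (hS _) (hZ₀.add (hS _)),
    covariance_add_right hZ₀ hZ₀ (hS _), covariance_add_right (hS _) hZ₀ (hS _), h0S,
    hS0, hSS, covariance_self hZ₀.aemeasurable, hmin]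
  ring

open Filter Topology in
/-- The centered and exponentially rescaled stationary Ornstein–Uhlenbeck process is a centered
Gaussian process. -/
lemma IsStationaryOU.isGaussianProcess_rescaled {Ω : Type*} [MeasurableSpace Ω] {P : Measure Ω}
    [IsProbabilityMeasure P] {κ θ σ : ℝ} (hκ : 0 < κ) {W X : ℝ≥0 → Ω → ℝ}
    (hX : IsStationaryOU κ θ σ W X P) :
    IsGaussianProcess (fun (t : ℝ≥0) ω => Real.exp (κ * t) * (X t ω - θ)) P ∧
    (∀ t : ℝ≥0, ∫ ω, Real.exp (κ * t) * (X t ω - θ) ∂P = 0) ∧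
    ∀ s t : ℝ≥0, cov[fun ω => Real.exp (κ * s) * (X s ω - θ),
      fun ω => Real.exp (κ * t) * (X t ω - θ); P] =
      σ ^ 2 / (2 * κ) * Real.exp (2 * κ * (min s t : ℝ≥0)) := by
  have hW := hX.brownian.toIsPreBrownianReal
  set Z₀ : Ω → ℝ := fun ω => X 0 ω - θ with hZ₀
  have hr : 0 ≤ σ ^ 2 / (2 * κ) := by positivity
  have hZ₀l : HasLaw Z₀ (gaussianReal 0 (σ ^ 2 / (2 * κ)).toNNReal) P := by
    have := gaussianReal_sub_const hX.initial θ
    simpa using this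
  have hZ₀g := hZ₀l.hasGaussianLaw
  have hind : IndepFun (fun ω (_ : Unit) => Z₀ ω) (fun ω t => W t ω) P :=
    hX.indep.comp (φ := fun x (_ : Unit) => x - θ) (ψ := id) (by fun_prop) measurable_id
  have hG : IsGaussianProcess (Sum.elim (fun _ : Unit => Z₀) W) P := by
    refine IndepFun.isGaussianProcess_sumElim ?_ hW.isGaussianProcess hind
    refine isGaussianProcess_of_forall_sum (fun _ => hZ₀g.aemeasurable) fun I c => ?_
    simp_rw [← Finset.sum_mul]
    exact hZ₀g.fun_smul _
  have hc : ∀ t, cov[Z₀, W t; P] = 0 := fun t =>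
    (hind.comp (measurable_pi_apply ()) (measurable_pi_apply t)).covariance_eq_zero
      hZ₀g.memLp_two (hW.isGaussianProcess.hasGaussianLaw_eval t).memLp_two
  refine isGaussianProcess_of_tendsto (X := fun k => eulerApprox κ σ Z₀ W k)
    (Z := fun (t : ℝ≥0) ω => Real.exp (κ * t) * (X t ω - θ))
    (C := fun s t => σ ^ 2 / (2 * κ) * Real.exp (2 * κ * (min s t : ℝ≥0)))
    (fun k => hG.of_mem_span fun t => eulerApprox_mem_span _ _ _ _ _ _) (fun k t => ?_)
    (fun t => ((hX.aemeasurable t).sub_const θ).const_mul _) (fun t => ?_) (fun s t => ?_)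
  · unfold eulerApprox
    have hi := hW.integrable_eval
    have hi' : ∀ j : ℕ, Integrable (fun ω => Real.exp (κ * ((j + 1) / (k + 1))) *
        (σ * (W ((j + 1) / (k + 1)) ω - W (j / (k + 1)) ω))) P :=
      fun j => (((hi _).sub (hi _)).const_mul _).const_mul _
    rw [integral_add hZ₀g.integrable (integrable_finsetSum _ fun j _ => hi' j),
      integral_finsetSum _ fun j _ => hi' j,
      hZ₀l.integral_eq, integral_id_gaussianReal, zero_add]
    refine Finset.sum_eq_zero fun j _ => ?_
    rw [integral_const_mul, integral_const_mul, integral_sub (hi _) (hi _), hW.integral_eval,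
      hW.integral_eval]
    simp
  · filter_upwards [hX.continuous_paths, hX.sde] with ω hcont hsde
    -- `toNNReal` extends the path by its initial value to negative times, giving a function
    -- continuous on all of ℝ.
    have hz : Continuous fun s : ℝ => X s.toNNReal ω - θ :=
      (hcont.comp continuous_real_toNNReal).sub continuous_const
    have := tendsto_euler_sum (κ := κ) (z := fun s => X s.toNNReal ω - θ)
      (v := fun s => σ * W s.toNNReal ω) hz (fun a b ha hab => ?_) t.2
    · have := this.const_add (X 0 ω - θ)
      simp only [Real.toNNReal_zero, NNReal.val_eq_coe, Real.toNNReal_coe] at this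
      convert this using 1
      · ext k
        rw [eulerApprox]
        congr 1
        refine Finset.sum_congr rfl fun j _ => ?_
        have h1 : (((j : ℝ) + 1) / (k + 1)).toNNReal = ((j : ℝ≥0) + 1) / (k + 1) := by
          rw [← Real.toNNReal_coe (r := ((j : ℝ≥0) + 1) / (k + 1))]; push_cast; rfl
        have h2 : ((j : ℝ) / (k + 1)).toNNReal = (j : ℝ≥0) / (k + 1) := by
          rw [← Real.toNNReal_coe (r := (j : ℝ≥0) / (k + 1))]; push_cast; rfl
        rw [h1, h2]
        ring
      · congr 1; ring
    · have hb := hsde b.toNNReal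
      have ha' := hsde a.toNNReal
      rw [Real.coe_toNNReal _ (ha.trans hab)] at hb
      rw [Real.coe_toNNReal _ ha] at ha'
      have hii : ∀ c d : ℝ, IntervalIntegrable (fun s : ℝ => κ * (θ - X s.toNNReal ω)) volume c d :=
        fun c d => Continuous.intervalIntegrable
          (continuous_const.mul (continuous_const.sub (hcont.comp continuous_real_toNNReal))) _ _
      have h3 := intervalIntegral.integral_add_adjacent_intervals (hii 0 a) (hii a b)
      have h4 : ∫ s in a..b, κ * (θ - X s.toNNReal ω) =
          -(κ * ∫ s in a..b, (X s.toNNReal ω - θ)) := by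
        rw [← intervalIntegral.integral_const_mul, ← intervalIntegral.integral_neg]
        congr 1; ext s; ring
      linarith
  · simp_rw [covariance_eulerApprox κ σ hW hZ₀g.memLp_two hc]
    -- The constant σ²/(2κ) solves the equation with rate 2κ and driver σ²s; the initial variance
    -- cancels the term -z 0 of the limit.
    have := tendsto_euler_sum (κ := 2 * κ) (z := fun _ => σ ^ 2 / (2 * κ))
      (v := fun s => σ ^ 2 * s) continuous_const (fun a b _ _ => ?_) (min s t).2
    · replace this := this.const_add (Var[Z₀; P])
      have hv : Var[Z₀; P] = σ ^ 2 / (2 * κ) := by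
        rw [hZ₀l.variance_eq, variance_id_gaussianReal, Real.coe_toNNReal _ hr]
      rw [NNReal.val_eq_coe] at this
      refine this.trans_eq ?_
      rw [hv, add_sub_cancel, mul_comm]
    · rw [intervalIntegral.integral_const, smul_eq_mul]
      field_simp
      ring

/-- The centered stationary Ornstein–Uhlenbeck process is a centered Gaussian process with
exponentially decaying covariance. -/
lemma IsStationaryOU.isGaussianProcess_centered {Ω : Type*} [MeasurableSpace Ω] {P : Measure Ω}
    [IsProbabilityMeasure P] {κ θ σ : ℝ} (hκ : 0 < κ) {W X : ℝ≥0 → Ω → ℝ}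
    (hX : IsStationaryOU κ θ σ W X P) :
    IsGaussianProcess (fun t ω => X t ω - θ) P ∧ (∀ t : ℝ≥0, ∫ ω, (X t ω - θ) ∂P = 0) ∧
    ∀ s t : ℝ≥0, s ≤ t → cov[fun ω => X s ω - θ, fun ω => X t ω - θ; P] =
      σ ^ 2 / (2 * κ) * Real.exp (-κ * (t - s)) := by
  obtain ⟨hG, hmean, hcov⟩ := hX.isGaussianProcess_rescaled hκ
  have hE : ∀ t : ℝ≥0, (fun ω => X t ω - θ) =
      fun ω => Real.exp (-κ * t) * (Real.exp (κ * t) * (X t ω - θ)) := by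
    intro t
    ext ω
    rw [← mul_assoc, ← Real.exp_add]
    simp
  refine ⟨?_, fun t => ?_, fun s t hst => ?_⟩
  · have := hG.smul fun t : ℝ≥0 => Real.exp (-κ * t)
    have hZ : (fun t ω => X t ω - θ) =
        fun (t : ℝ≥0) ω => Real.exp (-κ * t) • (Real.exp (κ * t) * (X t ω - θ)) := by
      ext t ω
      exact congrFun (hE t) ω
    rwa [hZ]
  · rw [hE t, integral_const_mul, hmean, mul_zero]
  · rw [hE s, hE t, covariance_const_mul_left, covariance_const_mul_right, hcov, min_eq_left hst]
    have : Real.exp (-κ * (t - s)) =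
        Real.exp (-κ * s) * (Real.exp (-κ * t) * Real.exp (2 * κ * s)) := by
      rw [← Real.exp_add, ← Real.exp_add]; congr 1; ring
    rw [this]
    ring

/-! ### Mutual information from an independent residual. -/

/-- The density of a shifted Gaussian with respect to another Gaussian, as a function of the point
and of a parameter that determines the shift. -/
noncomputable def gaussianShiftDensity {E : Type*} (L : E → ℝ) (θ : ℝ) (r w : ℝ≥0)
    (p : ℝ × E) : ℝ≥0∞ :=
  gaussianPDF (L p.2) w p.1 / gaussianPDF θ r p.1

lemma measurable_gaussianShiftDensity {E : Type*} [MeasurableSpace E] {L : E → ℝ}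
    (hL : Measurable L) (θ : ℝ) (r w : ℝ≥0) : Measurable (gaussianShiftDensity L θ r w) := by
  unfold gaussianShiftDensity gaussianPDF gaussianPDFReal
  fun_prop

/-- When `U - L V` has second moment w and `U - θ` has second moment r, each quadratic term averages
to 1/2; they cancel and only the logarithm is left. -/
lemma log_gaussianShiftDensity {E : Type*} (L : E → ℝ) (θ : ℝ) {r w : ℝ≥0} (hr : r ≠ 0)
    (hw : w ≠ 0) (p : ℝ × E) :
    Real.log (gaussianShiftDensity L θ r w p).toReal =
      1 / 2 * Real.log (r / w) - (p.1 - L p.2) ^ 2 / (2 * w) + (p.1 - θ) ^ 2 / (2 * r) := by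
  have hr' : (0 : ℝ) < r := by positivity
  have hw' : (0 : ℝ) < w := by positivity
  rw [gaussianShiftDensity, ENNReal.toReal_div, toReal_gaussianPDF, toReal_gaussianPDF,
    Real.log_div (gaussianPDFReal_pos _ _ _ hw).ne' (gaussianPDFReal_pos _ _ _ hr).ne',
    gaussianPDFReal, gaussianPDFReal, Real.log_mul (by positivity) (by positivity),
    Real.log_mul (by positivity) (by positivity), Real.log_exp, Real.log_exp, Real.log_inv,
    Real.log_inv, Real.log_sqrt (by positivity), Real.log_sqrt (by positivity),
    Real.log_mul (by positivity) hw'.ne', Real.log_mul (by positivity) hr'.ne',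
    Real.log_div hr'.ne' hw'.ne']
  ring

section MutualInfo

variable {Ω E : Type*} [MeasurableSpace Ω] [MeasurableSpace E] {P : Measure Ω}
  [IsProbabilityMeasure P] {U R : Ω → ℝ} {V : Ω → E} {L : E → ℝ} {θ : ℝ} {r w : ℝ≥0}

/-- Given V = y, the independence of R makes U Gaussian with mean L y and variance w. The joint
density relative to the product of the marginals is this conditional density divided by that of U.
-/
lemma map_prodMk_eq_withDensity_gaussianShiftDensity (hL : Measurable L) (hV : AEMeasurable V P)
    (hr : r ≠ 0) (hw : w ≠ 0) (hU : HasLaw U (gaussianReal θ r) P)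
    (hR : HasLaw R (gaussianReal 0 w) P) (hind : IndepFun R V P)
    (hUR : ∀ ω, U ω = L (V ω) + R ω) :
    P.map (fun ω => (U ω, V ω)) =
      ((P.map U).prod (P.map V)).withDensity (gaussianShiftDensity L θ r w) := by
  have hUm := hU.aemeasurable
  have hRm := hR.aemeasurable
  have hf := measurable_gaussianShiftDensity hL θ r w
  have := Measure.isProbabilityMeasure_map (μ := P) hV
  refine Measure.ext_of_lintegral _ fun g hg => ?_
  have hRV := (indepFun_iff_map_prod_eq_prod_map_map hRm hV).1 hind
  have hg' : Measurable fun p : ℝ × E => g (L p.2 + p.1, p.2) := by fun_prop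
  have h1 : ∫⁻ p, g p ∂(P.map fun ω => (U ω, V ω)) =
      ∫⁻ y, ∫⁻ x, g (L y + x, y) ∂(gaussianReal 0 w) ∂(P.map V) := by
    rw [lintegral_map' hg.aemeasurable (hUm.prodMk hV), ← hR.map_eq,
      ← lintegral_prod_symm' _ hg', ← hRV, lintegral_map' hg'.aemeasurable (hRm.prodMk hV)]
    simp_rw [hUR]
  have h2 : ∀ y, ∫⁻ x, g (L y + x, y) ∂(gaussianReal 0 w) =
      ∫⁻ x, gaussianPDF (L y) w x * g (x, y) := by
    intro y
    have hgy : Measurable fun x => g (x, y) := by fun_prop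
    rw [← lintegral_map (f := fun x => g (x, y)) (g := fun x => L y + x) hgy (by fun_prop),
      gaussianReal_map_const_add, zero_add, gaussianReal_of_var_ne_zero _ hw,
      lintegral_withDensity_eq_lintegral_mul _ (measurable_gaussianPDF _ _) hgy]
    rfl
  have h3 : ∀ y, ∫⁻ x, gaussianShiftDensity L θ r w (x, y) * g (x, y) ∂(gaussianReal θ r) =
      ∫⁻ x, gaussianPDF (L y) w x * g (x, y) := by
    intro y
    have hfy : Measurable fun x => gaussianShiftDensity L θ r w (x, y) * g (x, y) := by fun_prop
    rw [gaussianReal_of_var_ne_zero _ hr,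
      lintegral_withDensity_eq_lintegral_mul _ (measurable_gaussianPDF _ _) hfy]
    refine lintegral_congr fun x => ?_
    rw [Pi.mul_apply, ← mul_assoc, gaussianShiftDensity, ENNReal.mul_div_cancel
      (gaussianPDF_pos _ hr x).ne' (by simp [gaussianPDF])]
  rw [h1, lintegral_withDensity_eq_lintegral_mul _ hf hg, hU.map_eq]
  simp_rw [h2, Pi.mul_apply]
  rw [lintegral_prod_symm' _ (by fun_prop)]
  simp_rw [h3]

/-- The mutual information of a Gaussian variable and an observation, when the variable is a
function of the observation plus an independent centered Gaussian residual. -/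
lemma mutualInfo_of_indepFun_residual (hL : Measurable L) (hV : AEMeasurable V P)
    (hr : r ≠ 0) (hw : w ≠ 0) (hU : HasLaw U (gaussianReal θ r) P)
    (hR : HasLaw R (gaussianReal 0 w) P) (hind : IndepFun R V P)
    (hUR : ∀ ω, U ω = L (V ω) + R ω) :
    mutualInfo U V P ≠ ∞ ∧ (mutualInfo U V P).toReal = 1 / 2 * Real.log (r / w) := by
  have hUm := hU.aemeasurable
  have hUV : AEMeasurable (fun ω => (U ω, V ω)) P := hUm.prodMk hV
  have := Measure.isProbabilityMeasure_map hV
  have := Measure.isProbabilityMeasure_map hUm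
  have := Measure.isProbabilityMeasure_map hUV
  have hr' : (r : ℝ) ≠ 0 := by positivity
  have hw' : (w : ℝ) ≠ 0 := by positivity
  have hdens := map_prodMk_eq_withDensity_gaussianShiftDensity hL hV hr hw hU hR hind hUR
  have hac : P.map (fun ω => (U ω, V ω)) ≪ (P.map U).prod (P.map V) := by
    rw [hdens]; exact withDensity_absolutelyContinuous _ _
  set h : ℝ × E → ℝ := fun p =>
    1 / 2 * Real.log (r / w) - (p.1 - L p.2) ^ 2 / (2 * w) + (p.1 - θ) ^ 2 / (2 * r) with hh
  have hhm : Measurable h := by fun_prop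
  have hllr : llr (P.map fun ω => (U ω, V ω)) ((P.map U).prod (P.map V))
      =ᵐ[P.map fun ω => (U ω, V ω)] h := by
    -- The density is identified almost everywhere for the product measure; absolute continuity
    -- transfers this to the joint law.
    have h1 := hac.ae_le (Measure.rnDeriv_withDensity ((P.map U).prod (P.map V))
      (measurable_gaussianShiftDensity hL θ r w))
    rw [← hdens] at h1
    filter_upwards [h1] with p hp
    rw [llr, hp, log_gaussianShiftDensity L θ hr hw]
  have hU2 : MemLp U 2 P := hU.hasGaussianLaw.memLp_two
  have hR2 : MemLp R 2 P := hR.hasGaussianLaw.memLp_two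
  have hUθ : Integrable (fun ω => (U ω - θ) ^ 2) P := (hU2.sub (memLp_const θ)).integrable_sq
  have hRi : Integrable (fun ω => R ω ^ 2) P := hR2.integrable_sq
  have hcomp : (fun ω => h (U ω, V ω)) =
      fun ω => 1 / 2 * Real.log (r / w) - R ω ^ 2 / (2 * w) + (U ω - θ) ^ 2 / (2 * r) := by
    ext ω
    simp only [hh, hUR, add_sub_cancel_left]
  have hint : Integrable (fun ω => h (U ω, V ω)) P := by
    rw [hcomp]
    exact ((integrable_const _).sub (hRi.div_const _)).add (hUθ.div_const _)
  have hint' : Integrable (llr (P.map fun ω => (U ω, V ω)) ((P.map U).prod (P.map V)))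
      (P.map fun ω => (U ω, V ω)) := by
    rw [integrable_congr hllr]
    exact (integrable_map_measure hhm.aestronglyMeasurable hUV).2 hint
  refine ⟨InformationTheory.klDiv_ne_top hac hint', ?_⟩
  have hUvar : ∫ ω, (U ω - θ) ^ 2 ∂P = r := by
    have := hU.variance_eq
    rw [variance_id_gaussianReal, variance_eq_integral hUm, hU.integral_eq,
      integral_id_gaussianReal] at this
    exact this
  have hRvar : ∫ ω, R ω ^ 2 ∂P = w := by
    have := hR.variance_eq
    rw [variance_id_gaussianReal, variance_eq_integral hR.aemeasurable, hR.integral_eq,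
      integral_id_gaussianReal] at this
    simpa using this
  rw [mutualInfo, InformationTheory.toReal_klDiv hac hint', integral_congr_ae hllr,
    integral_map hUV hhm.aestronglyMeasurable, hcomp,
    integral_add (f := fun ω => 1 / 2 * Real.log (r / w) - R ω ^ 2 / (2 * w))
      ((integrable_const _).sub (hRi.div_const _)) (hUθ.div_const _),
    integral_sub (integrable_const _) (hRi.div_const _), integral_div, integral_div, hUvar, hRvar]
  simp only [integral_const, probReal_univ, smul_eq_mul, one_mul]
  field_simp
  ring

end MutualInfo

/-! ### Positive definiteness and the regularized inverse. -/

open Matrix in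
/-- A matrix `a i * a j * p (min i j)` with `p` positive and strictly increasing is positive
definite. -/
lemma posDef_of_apply_eq_mul_min {m : ℕ} {M : Matrix (Fin m) (Fin m) ℝ} {a p : Fin m → ℝ}
    (ha : ∀ i, a i ≠ 0) (hp : StrictMono p) (hp0 : ∀ i, 0 < p i)
    (hM : ∀ i j, M i j = a i * a j * p (min i j)) : M.PosDef := by
  -- This is p shifted by one with q 0 = 0, so the increments d are positive, the first being p 0,
  -- and sum back to p.
  set q : ℕ → ℝ := fun l => if h : l - 1 < m ∧ 0 < l then p ⟨l - 1, h.1⟩ else 0 with hq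
  have hq_succ : ∀ i : Fin m, q (i + 1) = p i := fun i => by simp [hq]
  have hq0 : q 0 = 0 := by simp [hq]
  set d : ℕ → ℝ := fun l => q (l + 1) - q l with hd
  have hdpos : ∀ l : Fin m, 0 < d l := by
    intro l
    obtain ⟨l, hl⟩ := l
    cases l with
    | zero => simpa [hd, hq0, hq_succ ⟨0, hl⟩] using hp0 ⟨0, hl⟩
    | succ l =>
      have h1 := hq_succ ⟨l + 1, hl⟩
      have h2 := hq_succ ⟨l, by omega⟩
      simp only at h1 h2
      simp only [hd, h1, h2, sub_pos]
      exact hp (by simp)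
  have hsum : ∀ i : Fin m, ∑ l : Fin m, (if l ≤ i then d l else 0) = p i := by
    intro i
    have h1 := Fin.sum_univ_eq_sum_range (fun l => if l ≤ (i : ℕ) then d l else 0) m
    have h2 : (Finset.range m).filter (fun l => l ≤ (i : ℕ)) = Finset.range (i + 1) := by
      ext l
      have := i.2
      simp only [Finset.mem_filter, Finset.mem_range]
      omega
    simp only [Fin.le_def]
    rw [h1, ← Finset.sum_filter, h2, hd, Finset.sum_range_sub, hq0, hq_succ, sub_zero]
  set B : Matrix (Fin m) (Fin m) ℝ := Matrix.of fun i l => if l ≤ i then a i else 0 with hB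
  have hBdet : IsUnit B := by
    have hdet : B.det = ∏ i, B i i := by
      refine Matrix.det_of_isLowerTriangular B fun i j hij => ?_
      have : i < j := hij
      simp [hB, this.not_ge]
    rw [Matrix.isUnit_iff_isUnit_det, hdet, isUnit_iff_ne_zero]
    exact Finset.prod_ne_zero_iff.2 fun i _ => by simpa [hB] using ha i
  -- Since p (min i j) sums d l over l ≤ i and l ≤ j, M factors through a triangular matrix with
  -- diagonal entries a i.
  have hfac : M = B * Matrix.diagonal (fun l : Fin m => d l) * star B := by
    ext i j
    rw [hM, Matrix.mul_apply, ← hsum, Finset.mul_sum]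
    refine Finset.sum_congr rfl fun l _ => ?_
    simp only [Matrix.mul_diagonal, star_eq_conjTranspose, conjTranspose_apply, hB, of_apply,
      star_trivial, le_min_iff]
    by_cases h1 : l ≤ i <;> by_cases h2 : l ≤ j <;> simp [h1, h2]
    ring
  rw [hfac, Matrix.IsUnit.posDef_star_right_conjugate_iff hBdet]
  exact Matrix.PosDef.diagonal hdpos

section RegularizedInverse

variable {m : ℕ} {S : Matrix (Fin (m + 1)) (Fin (m + 1)) ℝ} {s : ℝ}

lemma posDef_smul_inv_add_one (hS : S.PosDef) (hs : 0 < s) : (s • S⁻¹ + 1).PosDef :=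
  (hS.inv.smul hs).add Matrix.PosDef.one

/-- For S = Σ_X and s = σn² the right side is the covariance of the observed window, which puts A
into the normal equations. -/
lemma mul_smul_inv_add_one (hS : S.PosDef) : S * (s • S⁻¹ + 1) = S + s • 1 := by
  have hu := S.isUnit_iff_isUnit_det.1 hS.isUnit
  rw [Matrix.mul_add, Matrix.mul_smul, Matrix.mul_nonsing_inv _ hu, Matrix.mul_one]
  exact add_comm _ _

/-- The variance explained by the regression is an entry of S A⁻¹; this form reduces it to an entry
of A⁻¹. -/
lemma mul_inv_smul_inv_add_one (hS : S.PosDef) (hs : 0 < s) :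
    S * (s • S⁻¹ + 1)⁻¹ = S - s • (s • S⁻¹ + 1)⁻¹ := by
  have hA := (Matrix.isUnit_iff_isUnit_det _).1 (posDef_smul_inv_add_one hS hs).isUnit
  have h : S * (s • S⁻¹ + 1) * (s • S⁻¹ + 1)⁻¹ = S := Matrix.mul_nonsing_inv_cancel_right _ _ hA
  rw [mul_smul_inv_add_one hS, Matrix.add_mul, Matrix.smul_mul, Matrix.one_mul] at h
  exact eq_sub_of_add_eq h

/-- Cramer's rule; the cofactor sign is (-1)^(2m) = 1, and for m = 0 the minor is the empty
determinant 1. -/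
lemma inv_last_last_eq_det_removeLast_div (A : Matrix (Fin (m + 1)) (Fin (m + 1)) ℝ) :
    A⁻¹ (Fin.last m) (Fin.last m) = (removeLast A).det / A.det := by
  rw [Matrix.inv_def, Matrix.smul_apply, Matrix.adjugate_fin_succ_eq_det_submatrix,
    Ring.inverse_eq_inv', smul_eq_mul, Fin.succAbove_last, ← two_mul, pow_mul, neg_one_sq, one_pow,
    one_mul, div_eq_inv_mul]
  rfl

end RegularizedInverse

/-! ### Gaussian regression on the observed window. -/

/-- The residual of the linear regression of a variable of a centered Gaussian process on finitely
many others. -/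
lemma gaussian_regression_residual {Ω T ι : Type*} [MeasurableSpace Ω] [Fintype ι] {P : Measure Ω}
    [IsProbabilityMeasure P] {G : T → Ω → ℝ} (hG : IsGaussianProcess G P) {Z : Ω → ℝ}
    {Y : ι → Ω → ℝ} (hZ : Z ∈ Submodule.span ℝ (Set.range G))
    (hY : ∀ i, Y i ∈ Submodule.span ℝ (Set.range G)) (hZ0 : P[Z] = 0) (hY0 : ∀ i, P[Y i] = 0)
    {c : ι → ℝ} (hc : ∀ j, cov[Y j, Z; P] = ∑ i, cov[Y j, Y i; P] * c i) :
    HasLaw (fun ω => Z ω - ∑ i, c i * Y i ω)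
      (gaussianReal 0 (Var[Z; P] - ∑ i, c i * cov[Y i, Z; P]).toNNReal) P ∧
    IndepFun (fun ω => Z ω - ∑ i, c i * Y i ω) (fun ω i => Y i ω) P := by
  set R : Ω → ℝ := fun ω => Z ω - ∑ i, c i * Y i ω with hR
  have hRmem : R ∈ Submodule.span ℝ (Set.range G) := by
    have : R = Z - ∑ i, c i • Y i := by ext ω; simp [hR]
    rw [this]
    exact Submodule.sub_mem _ hZ
      (Submodule.sum_mem _ fun i _ => Submodule.smul_mem _ _ (hY i))
  have hZg := hG.hasGaussianLaw_of_mem_span hZ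
  have hYg := fun i => hG.hasGaussianLaw_of_mem_span (hY i)
  have hRg := hG.hasGaussianLaw_of_mem_span hRmem
  have hcY : ∀ i, MemLp (fun ω => c i * Y i ω) 2 P := fun i => (hYg i).memLp_two.const_mul _
  have hS : MemLp (fun ω => ∑ i, c i * Y i ω) 2 P := memLp_finsetSum _ fun i _ => hcY i
  have hcov : ∀ V : Ω → ℝ, MemLp V 2 P →
      cov[V, R; P] = cov[V, Z; P] - ∑ i, c i * cov[V, Y i; P] := by
    intro V hV
    rw [hR, covariance_fun_sub_right hV hZg.memLp_two hS, covariance_fun_sum_right hcY hV]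
    simp_rw [covariance_const_mul_right]
  -- The normal equations say exactly this; joint Gaussianity later upgrades it to independence.
  have hYR : ∀ j, cov[Y j, R; P] = 0 := by
    intro j
    rw [hcov _ (hYg j).memLp_two, hc, sub_eq_zero]
    exact Finset.sum_congr rfl fun i _ => mul_comm _ _
  constructor
  · refine ⟨hRg.aemeasurable, ?_⟩
    have hmean : P[R] = 0 := by
      rw [hR, integral_sub hZg.integrable (hS.integrable one_le_two), hZ0,
        integral_finsetSum _ fun i _ => (hcY i).integrable one_le_two]
      simp_rw [integral_const_mul, hY0]
      simp
    have hvar : Var[R; P] = Var[Z; P] - ∑ i, c i * cov[Y i, Z; P] := by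
      rw [← covariance_self hRg.aemeasurable, hcov _ hRg.memLp_two, covariance_comm R Z,
        hcov _ hZg.memLp_two, covariance_self hZg.aemeasurable]
      simp_rw [covariance_comm R, hYR, covariance_comm Z]
      simp
    rw [hRg.map_eq_gaussianReal, hmean, hvar]
  · have hRY : IsGaussianProcess (Sum.elim (fun _ : Unit => R) Y) P := by
      refine hG.of_mem_span fun i => ?_
      cases i with
      | inl _ => exact hRmem
      | inr i => exact hY i
    have := hRY.indepFun_of_covariance_eq_zero (fun _ => hRg.aemeasurable)
      (fun i => (hYg i).aemeasurable) (fun _ i => by rw [covariance_comm, hYR])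
    exact this.comp (measurable_pi_apply ()) measurable_id

/-- Finitely many independent real Gaussian variables form a Gaussian process. -/
lemma isGaussianProcess_of_iIndepFun {Ω ι : Type*} [MeasurableSpace Ω] [Finite ι] {P : Measure Ω}
    {N : ι → Ω → ℝ} (hN : ∀ i, HasGaussianLaw (N i) P) (h : iIndepFun N P) :
    IsGaussianProcess N P where
  hasGaussianLaw I := by
    have := Fintype.ofFinite ι
    exact (h.hasGaussianLaw hN).map (.pi fun i : I => .proj (i : ι))

lemma windowIndex_mem_Icc {n m : ℕ} (hm : m + 1 ≤ n) (j : Fin (m + 1)) :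
    windowIndex n (m + 1) j ∈ Set.Icc 1 n := by
  have := j.2
  simp only [windowIndex, Set.mem_Icc]
  omega

lemma windowIndex_last {n m : ℕ} (hm : m + 1 ≤ n) : windowIndex n (m + 1) (Fin.last m) = n := by
  simp only [windowIndex, Fin.val_last]
  omega

lemma strictMono_windowIndex (n m : ℕ) : StrictMono (windowIndex n m) := fun i j hij => by
  simp only [windowIndex]
  omega

section Observations

variable {Ω : Type*} [MeasurableSpace Ω] {P : Measure Ω} [IsProbabilityMeasure P]
  {κ θ σ σn : ℝ} {W X N : ℝ≥0 → Ω → ℝ} {n : ℕ} {τ τ' : ℕ → ℝ≥0}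

lemma IsStationaryOU.covariance_centered (hX : IsStationaryOU κ θ σ W X P) (hκ : 0 < κ)
    (s t : ℝ≥0) : cov[fun ω => X s ω - θ, fun ω => X t ω - θ; P] = cov[X s, X t; P] := by
  obtain ⟨hG, -⟩ := hX.isGaussianProcess_centered hκ
  have hi : ∀ u, Integrable (X u) P := fun u =>
    (((hG.hasGaussianLaw_eval u).integrable).add (integrable_const θ)).congr
      (.of_forall fun ω => sub_add_cancel (X u ω) θ)
  rw [covariance_sub_const_left (hi s), covariance_sub_const_right (hi t)]

lemma IsStationaryOU.covariance_eq (hX : IsStationaryOU κ θ σ W X P) (hκ : 0 < κ)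
    {s t : ℝ≥0} (hst : s ≤ t) :
    cov[X s, X t; P] = σ ^ 2 / (2 * κ) * Real.exp (-κ * (t - s)) := by
  rw [← hX.covariance_centered hκ, (hX.isGaussianProcess_centered hκ).2.2 s t hst]

lemma IsStationaryOU.variance_eq (hX : IsStationaryOU κ θ σ W X P) (hκ : 0 < κ) (t : ℝ≥0) :
    Var[X t; P] = σ ^ 2 / (2 * κ) := by
  rw [← covariance_self (hX.aemeasurable t), hX.covariance_eq hκ le_rfl]
  simp

lemma IsStationaryOU.hasLaw (hX : IsStationaryOU κ θ σ W X P) (hκ : 0 < κ) (t : ℝ≥0) :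
    HasLaw (X t) (gaussianReal θ (σ ^ 2 / (2 * κ)).toNNReal) P := by
  obtain ⟨hG, hmean, hcov⟩ := hX.isGaussianProcess_centered hκ
  have hg := hG.hasGaussianLaw_eval t
  have hv : Var[fun ω => X t ω - θ; P] = σ ^ 2 / (2 * κ) := by
    rw [← covariance_self hg.aemeasurable, hcov t t le_rfl]
    simp
  have hl : HasLaw (fun ω => X t ω - θ) (gaussianReal 0 (σ ^ 2 / (2 * κ)).toNNReal) P :=
    ⟨hg.aemeasurable, by rw [hg.map_eq_gaussianReal, hmean, hv]⟩
  simpa using gaussianReal_add_const hl θ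

/-- For s ≤ t, exp(-κ(t-s)) = exp(-κs)·exp(-κt)·exp(2κs): a rescaled kernel of min type, strictly
increasing in the distinct sampling times. -/
lemma posDef_sampleCovariance (hX : IsStationaryOU κ θ σ W X P) (hκ : 0 < κ) (hσ : 0 < σ) {m : ℕ}
    (hmn : m + 1 ≤ n) (hτ : StrictMonoOn τ (Set.Icc 1 n)) :
    (sampleCovariance n (m + 1) τ X P).PosDef := by
  have hmono : StrictMono fun j : Fin (m + 1) => τ (windowIndex n (m + 1) j) := fun i j hij =>
    hτ (windowIndex_mem_Icc hmn i) (windowIndex_mem_Icc hmn j) (strictMono_windowIndex _ _ hij)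
  refine posDef_of_apply_eq_mul_min
    (a := fun i => Real.exp (-κ * τ (windowIndex n (m + 1) i)))
    (p := fun i => σ ^ 2 / (2 * κ) * Real.exp (2 * κ * τ (windowIndex n (m + 1) i)))
    (fun i => (Real.exp_pos _).ne') (fun i j hij => ?_) (fun i => by positivity) fun i j => ?_
  · have : (τ (windowIndex n (m + 1) i) : ℝ) < τ (windowIndex n (m + 1) j) := hmono hij
    have hr : 0 < σ ^ 2 / (2 * κ) := by positivity
    simp only
    gcongr
  · wlog hij : i ≤ j generalizing i j
    · have := this j i (le_of_not_ge hij)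
      rw [min_comm, mul_comm (Real.exp _), ← this]
      exact covariance_comm _ _
    · rw [min_eq_left hij, sampleCovariance, Matrix.of_apply,
        hX.covariance_eq hκ (hmono.monotone hij), mul_left_comm, ← Real.exp_add, ← Real.exp_add]
      congr 2
      ring

/-- The mutual information of a later value of the process and a window of noisy observations, in
terms of the regularized covariance of the window. -/
lemma valueOfInformation_eq_log_div (hκ : 0 < κ) (hσ : 0 < σ) (hσn : 0 < σn) {m : ℕ}
    (hmn : m + 1 ≤ n) (hτ : StrictMonoOn τ (Set.Icc 1 n)) {t : ℝ≥0} (ht : τ n < t)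
    (hX : IsStationaryOU κ θ σ W X P) (hN : IsChannelNoise σn n τ' X N P) :
    valueOfInformation n (m + 1) τ τ' X N P t ≠ ∞ ∧
    (valueOfInformation n (m + 1) τ τ' X N P t).toReal =
      1 / 2 * Real.log (σ ^ 2 / (2 * κ) / (σ ^ 2 / (2 * κ) -
        Real.exp (-2 * κ * (t - τ n)) * (σ ^ 2 / (2 * κ) - σn ^ 2 *
          (matrixA σn n (m + 1) τ X P)⁻¹ (Fin.last m) (Fin.last m)))) := by
  set r := σ ^ 2 / (2 * κ) with hr_def
  have hr : 0 < r := by positivity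
  set S := sampleCovariance n (m + 1) τ X P with hS_def
  have hSpd : S.PosDef := posDef_sampleCovariance hX hκ hσ hmn hτ
  have hSsymm : ∀ i j, S i j = S j i := fun i j => covariance_comm _ _
  set A := matrixA σn n (m + 1) τ X P
  have hs : 0 < σn ^ 2 := by positivity
  have hApd : A.PosDef := posDef_smul_inv_add_one hSpd hs
  have hSA : S * A = S + σn ^ 2 • 1 := mul_smul_inv_add_one hSpd
  have hSAinv : S * A⁻¹ = S - σn ^ 2 • A⁻¹ := mul_inv_smul_inv_add_one hSpd hs
  set e := Real.exp (-κ * (t - τ n)) with he_def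
  have he2 : Real.exp (-2 * κ * (t - τ n)) = e ^ 2 := by
    rw [he_def, ← Real.exp_nat_mul]; congr 1; push_cast; ring
  set idx : Fin (m + 1) → Set.Icc 1 n := fun j => ⟨windowIndex n (m + 1) j,
    windowIndex_mem_Icc hmn j⟩ with hidx
  have hidx_inj : Function.Injective idx := fun i j hij =>
    (strictMono_windowIndex n (m + 1)).injective (congrArg Subtype.val hij)
  have hlast : windowIndex n (m + 1) (Fin.last m) = n := windowIndex_last hmn
  obtain ⟨hZg, hZ0, -⟩ := hX.isGaussianProcess_centered hκ
  set Z : ℝ≥0 → Ω → ℝ := fun u ω => X u ω - θ with hZ_def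
  have hNg : ∀ i : Set.Icc 1 n, HasGaussianLaw (N (τ' i)) P :=
    fun i => (hN.law i i.2).hasGaussianLaw
  have hNproc : IsGaussianProcess (fun i : Set.Icc 1 n => N (τ' i)) P :=
    isGaussianProcess_of_iIndepFun hNg hN.iIndep
  have hZN : IndepFun (fun ω u => Z u ω) (fun ω (i : Set.Icc 1 n) => N (τ' i) ω) P :=
    hN.indep.comp (φ := fun (x : ℝ≥0 → ℝ) u => x u - θ) (ψ := id) (by fun_prop) measurable_id
  have hG := hZN.isGaussianProcess_sumElim hZg hNproc
  set G := Sum.elim Z (fun i : Set.Icc 1 n => N (τ' i))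
  have hZmem : ∀ u, Z u ∈ Submodule.span ℝ (Set.range G) :=
    fun u => Submodule.subset_span ⟨Sum.inl u, rfl⟩
  have hNmem : ∀ i : Set.Icc 1 n, N (τ' i) ∈ Submodule.span ℝ (Set.range G) :=
    fun i => Submodule.subset_span ⟨Sum.inr i, rfl⟩
  set Y : Fin (m + 1) → Ω → ℝ := fun j => Z (τ (idx j)) + N (τ' (idx j)) with hY_def
  have hYmem : ∀ j, Y j ∈ Submodule.span ℝ (Set.range G) :=
    fun j => Submodule.add_mem _ (hZmem _) (hNmem _)
  have hZ2 : ∀ u, MemLp (Z u) 2 P := fun u => (hZg.hasGaussianLaw_eval u).memLp_two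
  have hN2 : ∀ i : Set.Icc 1 n, MemLp (N (τ' i)) 2 P := fun i => (hNg i).memLp_two
  have hN0 : ∀ i : Set.Icc 1 n, P[N (τ' i)] = 0 := fun i => by
    rw [(hN.law i i.2).integral_eq, integral_id_gaussianReal]
  have hY0 : ∀ j, P[Y j] = 0 := fun j => by
    have := integral_add ((hZ2 (τ (idx j))).integrable one_le_two)
      ((hN2 (idx j)).integrable one_le_two)
    rw [hN0, hZ0, add_zero] at this
    exact this
  have hcZN : ∀ u (i : Set.Icc 1 n), cov[Z u, N (τ' i); P] = 0 := fun u i =>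
    (hZN.comp (measurable_pi_apply u) (measurable_pi_apply i)).covariance_eq_zero (hZ2 u) (hN2 i)
  have hcNN : ∀ i j : Set.Icc 1 n, cov[N (τ' i), N (τ' j); P] = if i = j then σn ^ 2 else 0 := by
    intro i j
    split_ifs with h
    · rw [h, covariance_self (hNg j).aemeasurable, (hN.law j j.2).variance_eq,
        variance_id_gaussianReal, Real.coe_toNNReal _ hs.le]
    · exact (hN.iIndep.indepFun h).covariance_eq_zero (hN2 i) (hN2 j)
  -- All window times are at most τ n < t, so the exponential covariance factors through time τ n.
  have hcYZ : ∀ j, cov[Y j, Z t; P] = e * S j (Fin.last m) := by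
    intro j
    have hle : τ (idx j) ≤ τ n := by
      refine hτ.monotoneOn (idx j).2 ⟨by omega, le_rfl⟩ (idx j).2.2
    rw [hY_def, covariance_add_left (hZ2 _) (hN2 _) (hZ2 _), covariance_comm (N _), hcZN, add_zero,
      hX.covariance_centered hκ, hX.covariance_eq hκ (hle.trans ht.le), hS_def, sampleCovariance,
      Matrix.of_apply, hlast, hX.covariance_eq hκ hle, mul_left_comm, he_def, ← Real.exp_add]
    congr 2
    ring
  have hcYY : ∀ i j, cov[Y i, Y j; P] = (S * A) i j := by
    intro i j
    rw [hSA, hY_def, covariance_add_left (hZ2 _) (hN2 _) ((hZ2 _).add (hN2 _)),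
      covariance_add_right (hZ2 _) (hZ2 _) (hN2 _), covariance_add_right (hN2 _) (hZ2 _) (hN2 _),
      hcZN, covariance_comm (N _) (Z _), hcZN, hcNN, hX.covariance_centered hκ, Matrix.add_apply,
      Matrix.smul_apply, Matrix.one_apply]
    simp only [hidx_inj.eq_iff, add_zero, zero_add, smul_eq_mul, mul_ite, mul_one, mul_zero]
    rfl
  -- The solution of (S A) c = e · (last column of S).
  set c : Fin (m + 1) → ℝ := fun i => e * A⁻¹ i (Fin.last m) with hc_def
  have hAunit := (Matrix.isUnit_iff_isUnit_det _).1 hApd.isUnit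
  have hc : ∀ j, cov[Y j, Z t; P] = ∑ i, cov[Y j, Y i; P] * c i := by
    intro j
    have h : (S * A * A⁻¹) j (Fin.last m) = S j (Fin.last m) := by
      rw [Matrix.mul_nonsing_inv_cancel_right _ _ hAunit]
    rw [hcYZ, ← h, Matrix.mul_apply, Finset.mul_sum]
    refine Finset.sum_congr rfl fun i _ => ?_
    rw [hcYY]
    ring
  have hSll : S (Fin.last m) (Fin.last m) = r := by
    rw [hS_def, sampleCovariance, Matrix.of_apply, hX.covariance_eq hκ le_rfl]
    simp [hr_def]
  have hsum : ∑ i, c i * cov[Y i, Z t; P] =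
      e ^ 2 * (r - σn ^ 2 * A⁻¹ (Fin.last m) (Fin.last m)) := by
    have h : (S * A⁻¹) (Fin.last m) (Fin.last m) =
        r - σn ^ 2 * A⁻¹ (Fin.last m) (Fin.last m) := by
      rw [hSAinv, Matrix.sub_apply, hSll]; rfl
    rw [← h, Matrix.mul_apply, Finset.mul_sum]
    refine Finset.sum_congr rfl fun i _ => ?_
    rw [hcYZ, hSsymm i]
    ring
  have hZvar : Var[Z t; P] = r := by
    rw [← covariance_self (hZ2 t).aemeasurable, hX.covariance_centered hκ,
      hX.covariance_eq hκ le_rfl]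
    simp [hr_def]
  obtain ⟨hRlaw, hRind⟩ := gaussian_regression_residual hG (hZmem t) hYmem (hZ0 t) hY0 hc
  rw [hsum, hZvar] at hRlaw
  set w := r - e ^ 2 * (r - σn ^ 2 * A⁻¹ (Fin.last m) (Fin.last m)) with hw_def
  -- Here w = (1 - e²) r + e² σn² (A⁻¹)ₘₘ with e < 1.
  have hw : 0 < w := by
    have h1 : 0 < A⁻¹ (Fin.last m) (Fin.last m) := hApd.inv.diag_pos
    have h2 : e < 1 := by
      rw [he_def, Real.exp_lt_one_iff]
      have : (τ n : ℝ) < t := ht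
      nlinarith
    have h3 : 0 < e := Real.exp_pos _
    have h4 : e ^ 2 < 1 := by nlinarith
    have h5 : 0 < e ^ 2 * (σn ^ 2 * A⁻¹ (Fin.last m) (Fin.last m)) := by positivity
    nlinarith
  have hobs : (fun ω j => observation τ τ' X N (windowIndex n (m + 1) j) ω) =
      fun ω j => Y j ω + θ := by
    ext ω j
    simp only [observation, hY_def, hZ_def, hidx, Pi.add_apply]
    ring
  have hind : IndepFun (fun ω => Z t ω - ∑ i, c i * Y i ω)
      (fun ω j => observation τ τ' X N (windowIndex n (m + 1) j) ω) P := by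
    have := hRind.comp (φ := id) (ψ := fun (y : Fin (m + 1) → ℝ) j => y j + θ) measurable_id
      (by fun_prop)
    rw [hobs]
    exact this
  have hVm : AEMeasurable (fun ω j => observation τ τ' X N (windowIndex n (m + 1) j) ω) P := by
    rw [hobs]
    exact aemeasurable_pi_lambda _ fun j =>
      ((hZ2 _).aemeasurable.add (hN2 _).aemeasurable).add_const θ
  -- The regression used centered variables; the affine L restores the mean θ.
  have hmain := mutualInfo_of_indepFun_residual
    (L := fun y : Fin (m + 1) → ℝ => θ + ∑ i, c i * (y i - θ)) (by fun_prop) hVm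
    (Real.toNNReal_pos.2 hr).ne' (Real.toNNReal_pos.2 hw).ne' (hX.hasLaw hκ t) hRlaw hind
    (fun ω => by simp only [congrFun (congrFun hobs ω), add_sub_cancel_right, hZ_def]; ring)
  rw [Real.coe_toNNReal _ hr.le, Real.coe_toNNReal _ hw.le] at hmain
  rw [he2]
  exact hmain

end Observations

/-! ### The closed formula. -/

theorem proposition1 {Ω : Type*} [MeasurableSpace Ω] (P : Measure Ω) [IsProbabilityMeasure P]
    (κ θ σ σn : ℝ) (hκ : 0 < κ) (hσ : 0 < σ) (hσn : 0 < σn)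
    (n m : ℕ) (hm : 1 ≤ m) (hmn : m ≤ n)
    (τ τ' : ℕ → ℝ≥0) (t : ℝ≥0)
    (hτ : StrictMonoOn τ (Set.Icc 1 n)) (hτ' : StrictMonoOn τ' (Set.Icc 1 n))
    (hdelay : ∀ i ∈ Set.Icc 1 n, τ i < τ' i) (ht : τ' n < t)
    (W X N : ℝ≥0 → Ω → ℝ)
    (hX : IsStationaryOU κ θ σ W X P) (hN : IsChannelNoise σn n τ' X N P)
    (γ : ℝ) (hγ : γ = σ ^ 2 / (2 * κ * σn ^ 2)) :
    (∀ i ∈ Set.Icc 1 n, Var[X (τ i); P] / Var[N (τ' i); P] = γ) ∧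
    (sampleCovariance n m τ X P).det ≠ 0 ∧
    (matrixA σn n m τ X P).det ≠ 0 ∧
    valueOfInformation n m τ τ' X N P t ≠ ∞ ∧
    (valueOfInformation n m τ τ' X N P t).toReal =
      1 / 2 * Real.log (1 / (1 - Real.exp (-2 * κ * ((t : ℝ) - (τ n : ℝ)))))
        - 1 / 2 * Real.log (1 + 1 / (Real.exp (2 * κ * ((t : ℝ) - (τ n : ℝ))) - 1)
            * ((removeLast (matrixA σn n m τ X P)).det
                / (γ * (matrixA σn n m τ X P).det))) := by
  obtain ⟨m, rfl⟩ : ∃ k, m = k + 1 := ⟨m - 1, by omega⟩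
  have hn : n ∈ Set.Icc 1 n := ⟨by omega, le_rfl⟩
  have htn : τ n < t := (hdelay n hn).trans ht
  have hr : 0 < σ ^ 2 / (2 * κ) := by positivity
  have hs : 0 < σn ^ 2 := by positivity
  have hSpd := posDef_sampleCovariance hX hκ hσ hmn hτ
  have hApd : (matrixA σn n (m + 1) τ X P).PosDef := posDef_smul_inv_add_one hSpd hs
  obtain ⟨hfin, hval⟩ := valueOfInformation_eq_log_div hκ hσ hσn hmn hτ htn hX hN
  refine ⟨fun i hi => ?_, hSpd.det_pos.ne', hApd.det_pos.ne', hfin, ?_⟩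
  · rw [hX.variance_eq hκ, (hN.law i hi).variance_eq, variance_id_gaussianReal,
      Real.coe_toNNReal _ hs.le, hγ]
    field_simp
  · have hD : 0 < (matrixA σn n (m + 1) τ X P)⁻¹ (Fin.last m) (Fin.last m) :=
      hApd.inv.diag_pos
    rw [inv_last_last_eq_det_removeLast_div] at hval hD
    set A := matrixA σn n (m + 1) τ X P
    rw [div_mul_eq_div_div_swap, hγ, hval]
    set D := (removeLast A).det / A.det
    set x := 2 * κ * ((t : ℝ) - τ n) with hx
    have hxpos : 0 < x := by
      have : (τ n : ℝ) < t := htn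
      have : 0 < (t : ℝ) - τ n := sub_pos.2 this
      positivity
    have hneg : -2 * κ * ((t : ℝ) - τ n) = -x := by rw [hx]; ring
    have hE : 1 < Real.exp x := Real.one_lt_exp_iff.2 hxpos
    rw [hneg, Real.exp_neg]
    set E := Real.exp x
    have hE1 : 0 < E - 1 := sub_pos.2 hE
    have hE0 : 0 < E := by linarith
    have h1 : 0 < 1 - E⁻¹ := sub_pos.2 (inv_lt_one_of_one_lt₀ hE)
    have h2 : 0 < 1 + 1 / (E - 1) * (D / (σ ^ 2 / (2 * κ * σn ^ 2))) := by positivity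
    rw [← mul_sub, ← Real.log_div (by positivity) h2.ne']
    congr 2
    -- The residual variance factors because E⁻¹/(1 - E⁻¹) = 1/(E - 1) and σn² = r/γ.
    have h3 : σ ^ 2 / (2 * κ) - E⁻¹ * (σ ^ 2 / (2 * κ) - σn ^ 2 * D) =
        σ ^ 2 / (2 * κ) *
          ((1 - E⁻¹) * (1 + 1 / (E - 1) * (D / (σ ^ 2 / (2 * κ * σn ^ 2))))) := by
      field_simp
      ring
    rw [h3, div_mul_cancel_left₀ hr.ne', mul_inv, one_div (1 - E⁻¹)]
    exact (div_eq_mul_inv _ _).symm
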